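/- Let $A\in\mathbb R^{n\times n}$, $B\in\mathbb R^{n\times p}$, $C\in\mathbb R^{q\times n}$, $F\in\mathbb R^{r\times n}$ and $t_1>0$. Consider the linear system $\dot x=Ax+Bu$ with output $y=Cx$ and target $z=Fx$, where the inputs $u:[0,t_1]\to\mathbb R^p$ are integrable and a solution is a continuous $x:[0,t_1]\to\mathbb R^n$ with $x(t)=x(0)+\int_0^t(Ax(s)+Bu(s))\,ds$ for all $t\in[0,t_1]$. The triple $(C,A;F)$ is called functionally observable if, for every input $u$ and any two solutions $x,\tilde x$ under this same input, the equality $Cx(t)=C\tilde x(t)$ for all $t\in[0,t_1]$ implies $Fx(t)=F\tilde x(t)$ for all $t\in[0,t_1]$. For an $s\times n$ matrix $M$ put $\mathcal O(M,A)=\begin{bmatrix}M\\ MA\\ \vdots\\ MA^{n-1}\end{bmatrix}$, and let $\mathcal O=\mathcal O(C,A)$. The following statements are equivalent: 1. the triple $(C,A;F)$ is functionally observable; 2. $\operatorname{rank}\begin{bmatrix}\mathcal O\\ F\end{bmatrix}=\operatorname{rank}\mathcal O$; 3. $\operatorname{rank}\begin{bmatrix}\mathcal O\\ \mathcal O(F,A)\end{bmatrix}=\operatorname{rank}\mathcal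 O$. Moreover, let $P\in\mathbb C^{n\times n}$ be invertible with $J=PAP^{-1}=\operatorname{diag}(J_1,\dots,J_m)$ in Jordan form, where $J_k=\operatorname{diag}(J_{k1},\dots,J_{km_k})\in\mathbb C^{n_k\times n_k}$ consists of all the (upper triangular) Jordan blocks of the eigenvalue $\lambda_k$, and $\lambda_1,\dots,\lambda_m$ are distinct. Partition $FP^{-1}=[F_1\ \cdots\ F_m]$ accordingly. If $n_k>1$, the lead columns of $F_k$ are the $m_k$ columns of $F_k$ at the positions of the first columns of the blocks $J_{k1},\dots,J_{km_k}$; if $n_k=1$, $F_k$ has no lead columns. If for every $k$ with $F_k\neq0$ the lead columns of $F_k$ are linearly independent, then statements 1–3 are also equivalent to 4. $\operatorname{rank}\begin{bmatrix}\lambda I_n-A\\ C\\ F\end{bmatrix}=\operatorname{rank}\begin{bmatrix}\lambda I_n-A\\ C\end{bmatrix}$ for all $\lambda\in\mathbb C$. -/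

import Mathlib

namespace FunctObs

open Set MeasureTheory Matrix

/-- The observability matrix of `(M, N)`: the blocks `M`, `M N`, …, `M N ^ (n - 1)` stacked. -/
def obsMatrix {K : Type*} [CommRing K] {q n : ℕ} (M : Matrix (Fin q) (Fin n) K)
    (N : Matrix (Fin n) (Fin n) K) : Matrix (Fin n × Fin q) (Fin n) K :=
  Matrix.of fun i j => (M * N ^ (i.1 : ℕ)) i.2 j

/-- `x` is a (Carathéodory) solution on `[0, t₁]` of `x' = A x + B u`. -/
def IsSolution {n p : ℕ} (A : Matrix (Fin n) (Fin n) ℝ) (B : Matrix (Fin n) (Fin p) ℝ)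
    (t₁ : ℝ) (u : ℝ → Fin p → ℝ) (x : ℝ → Fin n → ℝ) : Prop :=
  ContinuousOn x (Icc 0 t₁) ∧
    ∀ t ∈ Icc 0 t₁, x t = x 0 + ∫ s in (0 : ℝ)..t, (A *ᵥ x s + B *ᵥ u s)

/-- Two trajectories driven by the same input and having the same output `C x` on `[0, t₁]`
have the same target `F x` on `[0, t₁]`. -/
def FunctionallyObservable {n p q r : ℕ} (A : Matrix (Fin n) (Fin n) ℝ)
    (B : Matrix (Fin n) (Fin p) ℝ) (C : Matrix (Fin q) (Fin n) ℝ)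
    (F : Matrix (Fin r) (Fin n) ℝ) (t₁ : ℝ) : Prop :=
  ∀ u : ℝ → Fin p → ℝ, IntervalIntegrable u volume 0 t₁ →
    ∀ x x' : ℝ → Fin n → ℝ, IsSolution A B t₁ u x → IsSolution A B t₁ u x' →
      (∀ t ∈ Icc 0 t₁, C *ᵥ x t = C *ᵥ x' t) → ∀ t ∈ Icc 0 t₁, F *ᵥ x t = F *ᵥ x' t

/-- A real matrix read as a complex one. -/
def toC {a b : Type*} (M : Matrix a b ℝ) : Matrix a b ℂ := M.map Complex.ofReal

/-- The `s × s` Jordan block with eigenvalue `l` and ones on the superdiagonal. -/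
def jordanBlock (l : ℂ) (s : ℕ) : Matrix (Fin s) (Fin s) ℂ :=
  Matrix.of fun i j => if i = j then l else if (i : ℕ) + 1 = j then 1 else 0

/-- The combinatorial data of a Jordan matrix: distinct eigenvalues `eig k`, and for each of them
the (positive) number of its Jordan blocks and their (positive) sizes. -/
structure JordanShape where
  m : ℕ
  eig : Fin m → ℂ
  eig_injective : Function.Injective eig
  numBlocks : Fin m → ℕ
  numBlocks_pos : ∀ k, 0 < numBlocks k
  size : (k : Fin m) → Fin (numBlocks k) → ℕ
  size_pos : ∀ k i, 0 < size k i

namespace JordanShape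

/-- The positions inside the `k`-th diagonal submatrix: a block and a place in that block. -/
abbrev SubIndex (S : JordanShape) (k : Fin S.m) : Type :=
  Σ i : Fin (S.numBlocks k), Fin (S.size k i)

/-- The positions of the whole Jordan matrix. -/
abbrev Index (S : JordanShape) : Type := Σ k : Fin S.m, S.SubIndex k

/-- The algebraic multiplicity of the `k`-th eigenvalue. -/
def mult (S : JordanShape) (k : Fin S.m) : ℕ := ∑ i, S.size k i

/-- The submatrix `J_k`, made of all the Jordan blocks of the `k`-th eigenvalue. -/
def subMat (S : JordanShape) (k : Fin S.m) : Matrix (S.SubIndex k) (S.SubIndex k) ℂ :=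
  Matrix.blockDiagonal' fun i => jordanBlock (S.eig k) (S.size k i)

/-- The Jordan matrix `J = diag(J_1, …, J_m)`. -/
def mat (S : JordanShape) : Matrix S.Index S.Index ℂ :=
  Matrix.blockDiagonal' S.subMat

/-- `J = P A P⁻¹` is the Jordan matrix of shape `S`; `e` says which of the rows and columns
`0, …, n - 1` is at which position of the Jordan matrix. -/
def IsDecomposition (S : JordanShape) {n : ℕ} (e : S.Index ≃ Fin n)
    (A P : Matrix (Fin n) (Fin n) ℂ) : Prop :=
  IsUnit P.det ∧ P * A * P⁻¹ = Matrix.reindex e e S.mat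

/-- The submatrix `M_k` of `M = [M_1 … M_m]`, of the columns that correspond to `J_k`. -/
def colPart (S : JordanShape) {n r : ℕ} (e : S.Index ≃ Fin n) (M : Matrix (Fin r) (Fin n) ℂ)
    (k : Fin S.m) : Matrix (Fin r) (S.SubIndex k) ℂ :=
  M.submatrix id fun j => e ⟨k, j⟩

/-- The lead columns of `M_k` (those at the first column of each Jordan block of the `k`-th
eigenvalue; there are none if the multiplicity is one) are linearly independent. -/
def LeadColumnsLI (S : JordanShape) {r : ℕ} (k : Fin S.m)
    (M : Matrix (Fin r) (S.SubIndex k) ℂ) : Prop :=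
  1 < S.mult k →
    LinearIndependent ℂ fun i : Fin (S.numBlocks k) => M.col ⟨i, ⟨0, S.size_pos k i⟩⟩

end JordanShape

/-- The generalized Popov–Belevitch–Hautus rank condition; ranks are over `ℂ`. -/
def GeneralizedPBH {n q r : ℕ} (A : Matrix (Fin n) (Fin n) ℝ) (C : Matrix (Fin q) (Fin n) ℝ)
    (F : Matrix (Fin r) (Fin n) ℝ) : Prop :=
  ∀ l : ℂ,
    (fromRows (l • (1 : Matrix (Fin n) (Fin n) ℂ) - toC A) (fromRows (toC C) (toC F))).rank =
      (fromRows (l • (1 : Matrix (Fin n) (Fin n) ℂ) - toC A) (toC C)).rank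

end FunctObs

/-! Every statement is compared with one condition: `F` vanishes on the unobservable subspace, the
largest `A`-invariant subspace inside `ker C`. For the two rank statements this is Cayley–Hamilton
together with invariance. For the dynamics (`functionallyObservable_iff`), the difference of two
solutions with equal input and output is a homogeneous trajectory with zero output, which lies in
that subspace; conversely each of its vectors starts a homogeneous trajectory that never leaves it.
The Hautus-type condition only says that `F` kills the eigenvectors in the complexified subspace.
Being invariant, that subspace is the sum of its intersections with the generalized eigenspaces. If
`F_k = 0`, or if the multiplicity is one, `F` vanishes on the intersection at once. Otherwise
independent lead columns make `F` injective on the eigenspace, so no unobservable eigenvector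
exists, and nilpotency forces the intersection to be zero. -/

namespace FunctObs

open Set MeasureTheory Matrix

/-! ### Rank equalities as inclusions of kernels. -/

section Rank

variable {K : Type*} [Field K]

/-- If `ker N ≤ ker M`, then `M` and `N` have the same rank iff they have the same kernel. -/
lemma rank_eq_iff_ker_le {a b c : Type*} [Fintype a] [Fintype b] [Fintype c]
    (N : Matrix a c K) (M : Matrix b c K)
    (h : ∀ v, N *ᵥ v = 0 → M *ᵥ v = 0) :
    N.rank = M.rank ↔ ∀ v, M *ᵥ v = 0 → N *ᵥ v = 0 := by
  classical
  have hle : LinearMap.ker N.mulVecLin ≤ LinearMap.ker M.mulVecLin := fun v hv => by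
    simpa using h v (by simpa using hv)
  have h1 := N.mulVecLin.finrank_range_add_finrank_ker
  have h2 := M.mulVecLin.finrank_range_add_finrank_ker
  unfold Matrix.rank
  constructor
  · intro hr v hv
    have := Submodule.eq_of_le_of_finrank_eq hle (by omega)
    have hv' : v ∈ LinearMap.ker M.mulVecLin := by simpa using hv
    rw [← this] at hv'
    simpa using hv'
  · intro hk
    have : LinearMap.ker N.mulVecLin = LinearMap.ker M.mulVecLin :=
      le_antisymm hle fun v hv => by simpa using hk v (by simpa using hv)
    rw [this] at h1
    omega

lemma fromRows_mulVec_eq_zero {R a b c : Type*} [CommRing R] [Fintype c]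
    (M : Matrix a c R) (N : Matrix b c R) (v : c → R) :
    fromRows M N *ᵥ v = 0 ↔ M *ᵥ v = 0 ∧ N *ᵥ v = 0 := by
  rw [fromRows_mulVec]
  constructor
  · intro h
    exact ⟨funext fun i => congrFun h (Sum.inl i), funext fun i => congrFun h (Sum.inr i)⟩
  · rintro ⟨h1, h2⟩
    rw [h1, h2]
    ext (i | i) <;> rfl

lemma rank_fromRows_eq_iff {a b c : Type*} [Fintype a] [Fintype b] [Fintype c]
    (M : Matrix a c K) (N : Matrix b c K) :
    (fromRows M N).rank = M.rank ↔ ∀ v, M *ᵥ v = 0 → N *ᵥ v = 0 := by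
  rw [rank_eq_iff_ker_le _ _ fun v hv => ((fromRows_mulVec_eq_zero M N v).1 hv).1]
  simp only [fromRows_mulVec_eq_zero]
  exact forall₂_congr fun v hv => and_iff_right hv

end Rank

/-! ### The unobservable subspace and Cayley–Hamilton. -/

section Unobservable

variable {K : Type*} [CommRing K] {q n : ℕ}

/-- The unobservable subspace: the vectors on which all `C A ^ k` vanish. -/
def unobservable (C : Matrix (Fin q) (Fin n) K) (A : Matrix (Fin n) (Fin n) K) :
    Submodule K (Fin n → K) :=
  ⨅ k : ℕ, LinearMap.ker (C * A ^ k).mulVecLin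

lemma mem_unobservable {C : Matrix (Fin q) (Fin n) K} {A : Matrix (Fin n) (Fin n) K}
    {v : Fin n → K} : v ∈ unobservable C A ↔ ∀ k : ℕ, (C * A ^ k) *ᵥ v = 0 := by
  simp [unobservable, Submodule.mem_iInf]

lemma mulVec_mem_unobservable {C : Matrix (Fin q) (Fin n) K} {A : Matrix (Fin n) (Fin n) K}
    {v : Fin n → K} (hv : v ∈ unobservable C A) : A *ᵥ v ∈ unobservable C A := by
  rw [mem_unobservable] at hv ⊢
  intro k
  rw [mulVec_mulVec, Matrix.mul_assoc, ← pow_succ]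
  exact hv (k + 1)

lemma pow_mulVec_mem_unobservable {C : Matrix (Fin q) (Fin n) K} {A : Matrix (Fin n) (Fin n) K}
    {v : Fin n → K} (hv : v ∈ unobservable C A) (k : ℕ) : A ^ k *ᵥ v ∈ unobservable C A := by
  induction k with
  | zero => simpa using hv
  | succ k ih =>
    rw [pow_succ', ← mulVec_mulVec]
    exact mulVec_mem_unobservable ih

lemma obsMatrix_mulVec_eq_zero (C : Matrix (Fin q) (Fin n) K) (A : Matrix (Fin n) (Fin n) K)
    (v : Fin n → K) :
    obsMatrix C A *ᵥ v = 0 ↔ ∀ k < n, (C * A ^ k) *ᵥ v = 0 := by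
  constructor
  · intro h k hk
    ext i
    exact congrFun h (⟨k, hk⟩, i)
  · intro h
    ext ⟨k, i⟩
    exact congrFun (h k k.2) i

/-- By Cayley–Hamilton, the kernel of the observability matrix is the unobservable subspace. -/
lemma obsMatrix_mulVec_eq_zero_iff_mem [Nontrivial K] (C : Matrix (Fin q) (Fin n) K)
    (A : Matrix (Fin n) (Fin n) K) (v : Fin n → K) :
    obsMatrix C A *ᵥ v = 0 ↔ v ∈ unobservable C A := by
  rw [obsMatrix_mulVec_eq_zero, mem_unobservable]
  refine ⟨fun h k => ?_, fun h k _ => h k⟩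
  -- For `n = 0` the remainder modulo `A.charpoly` cannot have `natDegree < n`.
  rcases Nat.eq_zero_or_pos n with rfl | hn
  · have : v = 0 := Subsingleton.elim _ _
    simp [this]
  have hdeg : (Polynomial.X ^ k %ₘ A.charpoly).natDegree < n := by
    have h1 : A.charpoly.natDegree = n := by simp
    have := Polynomial.natDegree_modByMonic_lt (Polynomial.X ^ k : Polynomial K)
      A.charpoly_monic (fun h1' => by rw [h1'] at h1; simp at h1; omega)
    omega
  rw [A.pow_eq_aeval_mod_charpoly, Polynomial.aeval_eq_sum_range' hdeg, Matrix.mul_sum,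
    Matrix.sum_mulVec]
  refine Finset.sum_eq_zero fun i hi => ?_
  rw [Matrix.mul_smul, smul_mulVec, h i (Finset.mem_range.1 hi), smul_zero]

lemma mulVec_eq_zero_of_mem_unobservable {C : Matrix (Fin q) (Fin n) K}
    {A : Matrix (Fin n) (Fin n) K} {v : Fin n → K} (hv : v ∈ unobservable C A) :
    C *ᵥ v = 0 := by
  simpa using mem_unobservable.1 hv 0

end Unobservable

/-! ### Trajectories and functional observability. -/

section Dynamics

/-- A continuous function all of whose integrals over `[0, t]` vanish is zero. -/
lemma eq_zero_of_forall_integral_eq_zero {E : Type*} [NormedAddCommGroup E] [NormedSpace ℝ E]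
    [CompleteSpace E] {h : ℝ → E} {b : ℝ} (hb : 0 < b) (hc : ContinuousOn h (Icc 0 b))
    (hi : ∀ t ∈ Icc 0 b, ∫ s in (0 : ℝ)..t, h s = 0) : ∀ t ∈ Icc 0 b, h t = 0 := by
  intro t ht
  have : Fact (t ∈ Icc 0 b) := ⟨ht⟩
  have hint : IntervalIntegrable h volume 0 t :=
    (hc.mono (by rw [uIcc_of_le ht.1]; exact Icc_subset_Icc_right ht.2)).intervalIntegrable
  have h1 : HasDerivWithinAt (fun u => ∫ s in (0 : ℝ)..u, h s) (h t) (Icc 0 b) t :=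
    intervalIntegral.integral_hasDerivWithinAt_right hint
      (hc.stronglyMeasurableAtFilter_nhdsWithin measurableSet_Icc t) (hc t ht)
  have h2 : HasDerivWithinAt (fun u => ∫ s in (0 : ℝ)..u, h s) 0 (Icc 0 b) t :=
    (hasDerivWithinAt_const t (Icc 0 b) (0 : E)).congr hi (hi t ht)
  exact (uniqueDiffOn_Icc hb t ht).eq_deriv _ h1 h2

variable {n p q r : ℕ} {A : Matrix (Fin n) (Fin n) ℝ} {B : Matrix (Fin n) (Fin p) ℝ}
  {C : Matrix (Fin q) (Fin n) ℝ} {F : Matrix (Fin r) (Fin n) ℝ} {t₁ : ℝ}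

lemma continuousOn_mulVec {a b : Type*} [Fintype a] [Fintype b] (M : Matrix a b ℝ)
    {x : ℝ → b → ℝ} {s : Set ℝ} (hx : ContinuousOn x s) : ContinuousOn (fun t => M *ᵥ x t) s :=
  (LinearMap.continuous_of_finiteDimensional M.mulVecLin).comp_continuousOn hx

lemma intervalIntegrable_mulVec {a b : Type*} [Fintype a] [Fintype b] (M : Matrix a b ℝ)
    {x : ℝ → b → ℝ} {c d : ℝ} (hx : IntervalIntegrable x volume c d) :
    IntervalIntegrable (fun t => M *ᵥ x t) volume c d :=
  ⟨M.mulVecLin.toContinuousLinearMap.integrable_comp hx.1,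
    M.mulVecLin.toContinuousLinearMap.integrable_comp hx.2⟩

lemma integral_mulVec {a b : Type*} [Fintype a] [Fintype b] (M : Matrix a b ℝ)
    {x : ℝ → b → ℝ} {c d : ℝ} (hx : IntervalIntegrable x volume c d) :
    ∫ t in c..d, M *ᵥ x t = M *ᵥ ∫ t in c..d, x t :=
  M.mulVecLin.toContinuousLinearMap.intervalIntegral_comp_comm hx

/-- The difference of two solutions under the same input solves the homogeneous equation. -/
lemma IsSolution.sub_eq {u : ℝ → Fin p → ℝ} {x x' : ℝ → Fin n → ℝ}
    (hu : IntervalIntegrable u volume 0 t₁) (hx : IsSolution A B t₁ u x)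
    (hx' : IsSolution A B t₁ u x') {t : ℝ} (ht : t ∈ Icc 0 t₁) :
    x t - x' t = x 0 - x' 0 + ∫ s in (0 : ℝ)..t, A *ᵥ (x s - x' s) := by
  have hsub : uIcc 0 t ⊆ Icc 0 t₁ := by
    rw [uIcc_of_le ht.1]; exact Icc_subset_Icc_right ht.2
  have hBu : IntervalIntegrable (fun s => B *ᵥ u s) volume 0 t :=
    intervalIntegrable_mulVec B
      (hu.mono_set (by rwa [uIcc_of_le (ht.1.trans ht.2)]))
  have key : ∀ y : ℝ → Fin n → ℝ, IsSolution A B t₁ u y →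
      IntervalIntegrable (fun s => A *ᵥ y s + B *ᵥ u s) volume 0 t := fun y hy =>
    ((continuousOn_mulVec A hy.1).mono hsub).intervalIntegrable.add hBu
  rw [hx.2 t ht, hx'.2 t ht, add_sub_add_comm,
    ← intervalIntegral.integral_sub (key x hx) (key x' hx')]
  simp only [mulVec_sub, add_sub_add_right_eq_sub]

/-- A solution of the homogeneous equation with zero output stays in the unobservable subspace. -/
lemma mem_unobservable_of_output_eq_zero (ht₁ : 0 < t₁) {d : ℝ → Fin n → ℝ}
    (hc : ContinuousOn d (Icc 0 t₁))
    (hd : ∀ t ∈ Icc 0 t₁, d t = d 0 + ∫ s in (0 : ℝ)..t, A *ᵥ d s)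
    (hC : ∀ t ∈ Icc 0 t₁, C *ᵥ d t = 0) : ∀ t ∈ Icc 0 t₁, d t ∈ unobservable C A := by
  suffices h : ∀ k : ℕ, ∀ t ∈ Icc 0 t₁, (C * A ^ k) *ᵥ d t = 0 from
    fun t ht => mem_unobservable.2 fun k => h k t ht
  intro k
  induction k with
  | zero => simpa using hC
  | succ k ih =>
    refine eq_zero_of_forall_integral_eq_zero ht₁ (continuousOn_mulVec _ hc) fun t ht => ?_
    have hsub : uIcc 0 t ⊆ Icc 0 t₁ := by
      rw [uIcc_of_le ht.1]; exact Icc_subset_Icc_right ht.2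
    have hint : IntervalIntegrable (fun s => A *ᵥ d s) volume 0 t :=
      ((continuousOn_mulVec A hc).mono hsub).intervalIntegrable
    -- The integral is `d t - d 0`, and `C * A ^ k` kills both terms; this replaces differentiating
    -- the output.
    have h1 : (C * A ^ k) *ᵥ ∫ s in (0 : ℝ)..t, A *ᵥ d s = 0 := by
      rw [eq_sub_of_add_eq' (hd t ht).symm, mulVec_sub, ih t ht, ih 0 ⟨le_rfl, ht₁.le⟩, sub_zero]
    rw [← integral_mulVec _ hint] at h1
    simpa only [mulVec_mulVec, Matrix.mul_assoc, ← pow_succ] using h1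

/-- A linear autonomous equation has a solution through every initial state. -/
lemma exists_linear_flow {E : Type*} [NormedAddCommGroup E] [NormedSpace ℝ E] [CompleteSpace E]
    (L : E →L[ℝ] E) (v : E) : ∃ x : ℝ → E, x 0 = v ∧ ∀ t, HasDerivAt x (L (x t)) t := by
  refine ⟨fun t => NormedSpace.exp (t • L) v, by simp, fun t => ?_⟩
  simpa using (hasDerivAt_exp_smul_const' L t).clm_apply (hasDerivAt_const t v)

/-- A vector of the unobservable subspace is the initial state of a solution of the homogeneous
equation that stays in that subspace. -/
lemma exists_solution_mem_unobservable (A : Matrix (Fin n) (Fin n) ℝ)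
    (C : Matrix (Fin q) (Fin n) ℝ) {v : Fin n → ℝ} (hv : v ∈ unobservable C A) :
    ∃ x : ℝ → Fin n → ℝ, x 0 = v ∧ (∀ t, x t ∈ unobservable C A) ∧
      ∀ t, HasDerivAt x (A *ᵥ x t) t := by
  -- Solving the equation inside the subspace makes its invariance under the flow automatic.
  let L : unobservable C A →L[ℝ] unobservable C A :=
    (A.mulVecLin.restrict fun _ hw => mulVec_mem_unobservable hw).toContinuousLinearMap
  obtain ⟨x, hx0, hx⟩ := exists_linear_flow L ⟨v, hv⟩
  exact ⟨fun t => x t, by simp [hx0], fun t => (x t).2, fun t =>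
    (unobservable C A).subtypeL.hasFDerivAt.comp_hasDerivAt t (hx t)⟩

lemma functionallyObservable_iff (B : Matrix (Fin n) (Fin p) ℝ) (ht₁ : 0 < t₁) :
    FunctionallyObservable A B C F t₁ ↔ ∀ v ∈ unobservable C A, F *ᵥ v = 0 := by
  constructor
  · intro h v hv
    obtain ⟨x, rfl, hmem, hx⟩ := exists_solution_mem_unobservable A C hv
    have hcont : Continuous x := continuous_iff_continuousAt.2 fun t => (hx t).continuousAt
    have hAx : Continuous fun t => A *ᵥ x t :=
      (LinearMap.continuous_of_finiteDimensional A.mulVecLin).comp hcont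
    -- Under zero input, `x` is compared with the zero solution at time `0`.
    have := h 0 intervalIntegrable_const x 0 ⟨hcont.continuousOn, fun t _ => ?_⟩
      ⟨continuousOn_const, fun t _ => by simp⟩
      (fun t _ => by simpa using mulVec_eq_zero_of_mem_unobservable (hmem t)) 0 ⟨le_rfl, ht₁.le⟩
    · simpa using this
    · have := intervalIntegral.integral_eq_sub_of_hasDerivAt (fun s _ => hx s)
        (hAx.intervalIntegrable 0 t)
      simp [this]
  · intro h u hu x x' hx hx' hC t ht
    rw [← sub_eq_zero, ← mulVec_sub]
    refine h _ (mem_unobservable_of_output_eq_zero (d := fun t => x t - x' t) ht₁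
      (hx.1.sub hx'.1) (fun t ht => hx.sub_eq hu hx' ht) (fun t ht => ?_) t ht)
    rw [mulVec_sub, hC t ht, sub_self]

end Dynamics

/-! ### Passage from real to complex vectors. -/

section Complexification

variable {a b : Type*} [Fintype b]

lemma toC_mulVec_eq_zero (M : Matrix a b ℝ) (w : b → ℂ) :
    toC M *ᵥ w = 0 ↔ M *ᵥ (fun j => (w j).re) = 0 ∧ M *ᵥ (fun j => (w j).im) = 0 := by
  simp only [funext_iff, mulVec, dotProduct, toC, map_apply, Pi.zero_apply, Complex.ext_iff,
    Complex.re_sum, Complex.im_sum, Complex.re_ofReal_mul, Complex.im_ofReal_mul,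
    Complex.zero_re, Complex.zero_im, forall_and]

lemma toC_mul {c : Type*} (M : Matrix a b ℝ) (N : Matrix b c ℝ) : toC (M * N) = toC M * toC N :=
  Matrix.map_mul (f := Complex.ofRealHom)

lemma toC_pow [DecidableEq b] (M : Matrix b b ℝ) (k : ℕ) : toC (M ^ k) = toC M ^ k :=
  map_pow Complex.ofRealHom.mapMatrix M k

lemma mem_unobservable_toC {q n : ℕ} (C : Matrix (Fin q) (Fin n) ℝ)
    (A : Matrix (Fin n) (Fin n) ℝ) (w : Fin n → ℂ) :
    w ∈ unobservable (toC C) (toC A) ↔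
      (fun j => (w j).re) ∈ unobservable C A ∧ (fun j => (w j).im) ∈ unobservable C A := by
  simp only [mem_unobservable, ← toC_pow, ← toC_mul, toC_mulVec_eq_zero, forall_and]

/-- Real matrices act separately on real and imaginary parts, so nothing is lost in moving to `ℂ`,
where the eigenvectors live. -/
lemma forall_unobservable_toC_iff {q r n : ℕ} (A : Matrix (Fin n) (Fin n) ℝ)
    (C : Matrix (Fin q) (Fin n) ℝ) (F : Matrix (Fin r) (Fin n) ℝ) :
    (∀ w ∈ unobservable (toC C) (toC A), toC F *ᵥ w = 0) ↔
      ∀ v ∈ unobservable C A, F *ᵥ v = 0 := by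
  constructor
  · intro h v hv
    have := h (fun j => (v j : ℂ)) ((mem_unobservable_toC C A _).2
      ⟨by simpa using hv, (unobservable C A).zero_mem⟩)
    simpa using ((toC_mulVec_eq_zero F _).1 this).1
  · intro h w hw
    rw [mem_unobservable_toC] at hw
    exact (toC_mulVec_eq_zero F w).2 ⟨h _ hw.1, h _ hw.2⟩

end Complexification

/-! ### The Hautus-type condition in terms of eigenvectors. -/

lemma smul_one_sub_mulVec_eq_zero {R b : Type*} [CommRing R] [Fintype b] [DecidableEq b]
    (A : Matrix b b R) (l : R) (w : b → R) :
    (l • (1 : Matrix b b R) - A) *ᵥ w = 0 ↔ A *ᵥ w = l • w := by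
  rw [sub_mulVec, smul_mulVec, one_mulVec, sub_eq_zero, eq_comm]

lemma generalizedPBH_iff {n q r : ℕ} (A : Matrix (Fin n) (Fin n) ℝ) (C : Matrix (Fin q) (Fin n) ℝ)
    (F : Matrix (Fin r) (Fin n) ℝ) :
    GeneralizedPBH A C F ↔
      ∀ (l : ℂ) (w : Fin n → ℂ), toC A *ᵥ w = l • w → toC C *ᵥ w = 0 → toC F *ᵥ w = 0 := by
  refine forall_congr' fun l => ?_
  rw [rank_eq_iff_ker_le]
  · simp only [fromRows_mulVec_eq_zero, smul_one_sub_mulVec_eq_zero]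
    exact forall_congr' fun w => ⟨fun h h1 h2 => (h ⟨h1, h2⟩).2.2,
      fun h h1 => ⟨h1.1, h1.2, h h1.1 h1.2⟩⟩
  · intro w
    simp only [fromRows_mulVec_eq_zero]
    exact fun h => ⟨h.1, h.2.1⟩

lemma mem_unobservable_of_eigenvector {K : Type*} [CommRing K] {q n : ℕ}
    {C : Matrix (Fin q) (Fin n) K} {A : Matrix (Fin n) (Fin n) K} {l : K} {w : Fin n → K}
    (hA : A *ᵥ w = l • w) (hC : C *ᵥ w = 0) : w ∈ unobservable C A := by
  have hpow : ∀ k : ℕ, A ^ k *ᵥ w = l ^ k • w := fun k => by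
    induction k with
    | zero => simp
    | succ k ih => rw [pow_succ, ← mulVec_mulVec, hA, mulVec_smul, ih, smul_smul, pow_succ']
  refine mem_unobservable.2 fun k => ?_
  rw [← mulVec_mulVec, hpow, mulVec_smul, hC, smul_zero]

/-! ### Jordan coordinates and the lead-column hypothesis. -/

namespace JordanShape

variable (S : JordanShape)

lemma jordanBlock_mulVec (l : ℂ) (s : ℕ) (y : Fin s → ℂ) (j : Fin s) :
    (jordanBlock l s *ᵥ y) j = l * y j + if h : (j : ℕ) + 1 < s then y ⟨j + 1, h⟩ else 0 := by
  have hterm : ∀ i : Fin s, jordanBlock l s j i * y i =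
      (if j = i then l * y i else 0) + if (j : ℕ) + 1 = i then y i else 0 := by
    intro i
    by_cases hij : j = i
    · subst hij; simp [jordanBlock]
    · simp [jordanBlock, hij]
  simp only [mulVec, dotProduct, hterm, Finset.sum_add_distrib, Finset.sum_ite_eq,
    Finset.mem_univ, if_true]
  congr 1
  split_ifs with h
  · rw [Finset.sum_eq_single (⟨j + 1, h⟩ : Fin s)]
    · simp
    · intro i _ hi
      exact if_neg fun hji => hi (Fin.ext hji.symm)
    · simp
  · exact Finset.sum_eq_zero fun i _ => if_neg fun hji => h (by omega)

lemma blockDiagonal'_mulVec {o R : Type*} {m' n' : o → Type*} [CommRing R] [Fintype o]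
    [DecidableEq o] [∀ k, Fintype (n' k)] (M : ∀ k, Matrix (m' k) (n' k) R)
    (y : (Σ k, n' k) → R) (k : o) (i : m' k) :
    (blockDiagonal' M *ᵥ y) ⟨k, i⟩ = (M k *ᵥ fun j => y ⟨k, j⟩) i := by
  simp only [mulVec, dotProduct, Fintype.sum_sigma]
  rw [Finset.sum_eq_single k]
  · simp only [blockDiagonal'_apply_eq]
  · intro k' _ hk'
    exact Finset.sum_eq_zero fun j _ => by rw [blockDiagonal'_apply_ne M i j hk'.symm, zero_mul]
  · simp

lemma mat_mulVec (y : S.Index → ℂ) (k : Fin S.m) (i : Fin (S.numBlocks k))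
    (j : Fin (S.size k i)) :
    (S.mat *ᵥ y) ⟨k, i, j⟩ = S.eig k * y ⟨k, i, j⟩ +
      if h : (j : ℕ) + 1 < S.size k i then y ⟨k, i, ⟨j + 1, h⟩⟩ else 0 := by
  rw [mat, blockDiagonal'_mulVec, subMat, blockDiagonal'_mulVec, jordanBlock_mulVec]

variable {n : ℕ} (e : S.Index ≃ Fin n) {A P : Matrix (Fin n) (Fin n) ℂ}

/-- The coordinates of a vector in the Jordan basis. -/
def coord (P : Matrix (Fin n) (Fin n) ℂ) (w : Fin n → ℂ) : S.Index → ℂ :=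
  fun j => (P *ᵥ w) (e j)

variable {S e}

lemma eq_zero_of_coord_eq_zero (hP : IsUnit P.det) {w : Fin n → ℂ}
    (h : ∀ j, S.coord e P w j = 0) : w = 0 := by
  have h1 : P *ᵥ w = 0 := by
    ext i
    simpa [coord] using h (e.symm i)
  rw [← one_mulVec w, ← nonsing_inv_mul P hP, ← mulVec_mulVec, h1, mulVec_zero]

lemma IsDecomposition.coord_mulVec (h : S.IsDecomposition e A P) (w : Fin n → ℂ) :
    S.coord e P (A *ᵥ w) = S.mat *ᵥ S.coord e P w := by
  have h1 : P * A = reindex e e S.mat * P := by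
    rw [← h.2, Matrix.mul_assoc, nonsing_inv_mul P h.1, Matrix.mul_one]
  ext j
  simp only [coord, mulVec_mulVec, h1]
  rw [← mulVec_mulVec, reindex_apply, submatrix_mulVec_equiv]
  simp only [Function.comp_def, Equiv.symm_symm, Equiv.symm_apply_apply]
  rfl

/-- The recurrence along a Jordan block from which coordinates are read off below. -/
lemma IsDecomposition.coord_sub_smul (h : S.IsDecomposition e A P) (μ : ℂ) (w : Fin n → ℂ)
    (k : Fin S.m) (i : Fin (S.numBlocks k)) (j : Fin (S.size k i)) :
    S.coord e P ((A.mulVecLin - μ • 1) w) ⟨k, i, j⟩ = (S.eig k - μ) * S.coord e P w ⟨k, i, j⟩ +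
      if h : (j : ℕ) + 1 < S.size k i then S.coord e P w ⟨k, i, ⟨j + 1, h⟩⟩ else 0 := by
  have h1 : S.coord e P ((A.mulVecLin - μ • 1) w) =
      S.mat *ᵥ S.coord e P w - μ • S.coord e P w := by
    rw [← h.coord_mulVec]
    ext j
    simp [coord, mulVec_sub, mulVec_smul]
  rw [h1, Pi.sub_apply, Pi.smul_apply, mat_mulVec, smul_eq_mul]
  ring

/-- The coordinates at the eigenvalues other than `μ` vanish on the generalized eigenspace. -/
lemma IsDecomposition.coord_eq_zero (h : S.IsDecomposition e A P) {μ : ℂ} {k : Fin S.m}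
    (hk : S.eig k ≠ μ) {w : Fin n → ℂ} (hw : w ∈ Module.End.maxGenEigenspace A.mulVecLin μ)
    (j : S.SubIndex k) : S.coord e P w ⟨k, j⟩ = 0 := by
  obtain ⟨N, hN⟩ := (Module.End.mem_maxGenEigenspace _ _ _).1 hw
  clear hw
  induction N generalizing w j with
  | zero =>
    have : w = 0 := by simpa using hN
    simp [this, coord]
  | succ N ih =>
    obtain ⟨i, j⟩ := j
    have h0 := fun j => ih (w := (A.mulVecLin - μ • 1) w) ⟨i, j⟩
      (by rwa [pow_succ, Module.End.mul_apply] at hN)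
    simp only [h.coord_sub_smul] at h0
    have hne := sub_ne_zero.2 hk
    -- The recurrence is solved backwards from the end of the block, by induction on the distance to
    -- it.
    generalize hd : S.size k i - j = d
    induction d generalizing j with
    | zero => omega
    | succ d ihd =>
      have hj := h0 j
      split_ifs at hj with hlt
      · rw [ihd ⟨j + 1, hlt⟩ (by simp only; omega), add_zero] at hj
        exact (mul_eq_zero.1 hj).resolve_left hne
      · rw [add_zero] at hj
        exact (mul_eq_zero.1 hj).resolve_left hne

/-- On the generalized eigenspace of `eig k` a matrix `F` acts through its part `F_k`. -/
lemma IsDecomposition.mulVec_eq_colPart {r : ℕ} (h : S.IsDecomposition e A P)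
    (F : Matrix (Fin r) (Fin n) ℂ) (k : Fin S.m) {w : Fin n → ℂ}
    (hw : w ∈ Module.End.maxGenEigenspace A.mulVecLin (S.eig k)) :
    F *ᵥ w = S.colPart e (F * P⁻¹) k *ᵥ fun j => S.coord e P w ⟨k, j⟩ := by
  have h1 : F *ᵥ w = (F * P⁻¹) *ᵥ (P *ᵥ w) := by
    rw [mulVec_mulVec, Matrix.mul_assoc, nonsing_inv_mul P h.1, Matrix.mul_one]
  rw [h1]
  ext a
  change ∑ i, (F * P⁻¹) a i * (P *ᵥ w) i =
    ∑ j, (F * P⁻¹) a (e ⟨k, j⟩) * S.coord e P w ⟨k, j⟩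
  rw [← e.sum_comp, Fintype.sum_sigma, Finset.sum_eq_single k]
  · rfl
  · intro k' _ hk'
    refine Finset.sum_eq_zero fun j _ => ?_
    have h0 := h.coord_eq_zero (fun he => hk' (S.eig_injective he)) hw j
    rw [coord] at h0
    rw [h0, mul_zero]
  · simp

variable {q r : ℕ} {C : Matrix (Fin q) (Fin n) ℂ} {F : Matrix (Fin r) (Fin n) ℂ}

lemma sub_smul_mem_unobservable (μ : ℂ) {w : Fin n → ℂ} (hw : w ∈ unobservable C A) :
    (A.mulVecLin - μ • 1) w ∈ unobservable C A := by
  simpa using sub_mem (mulVec_mem_unobservable hw) ((unobservable C A).smul_mem μ hw)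

/-- If the lead columns of `F_k` are linearly independent, `F` is injective on the eigenspace. -/
lemma IsDecomposition.eq_zero_of_eigenvector (h : S.IsDecomposition e A P) {k : Fin S.m}
    (hlead : LinearIndependent ℂ fun i : Fin (S.numBlocks k) =>
      (S.colPart e (F * P⁻¹) k).col ⟨i, ⟨0, S.size_pos k i⟩⟩)
    {w : Fin n → ℂ} (hw : (A.mulVecLin - S.eig k • 1) w = 0) (hF : F *ᵥ w = 0) : w = 0 := by
  have hgen : w ∈ Module.End.maxGenEigenspace A.mulVecLin (S.eig k) :=
    (Module.End.mem_maxGenEigenspace _ _ _).2 ⟨1, by simpa using hw⟩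
  have hpos : ∀ i (j : Fin (S.size k i)), (j : ℕ) ≠ 0 → S.coord e P w ⟨k, i, j⟩ = 0 := by
    intro i j hj
    -- At the matching eigenvalue, entry `j - 1` of the image is coordinate `j` of `w`; only first
    -- positions of blocks survive.
    have h0 := h.coord_sub_smul (S.eig k) w k i ⟨j - 1, by omega⟩
    have hj1 : (j : ℕ) - 1 + 1 = j := by omega
    simpa [hw, coord, hj1] using h0.symm
  have hsum : ∑ i, S.coord e P w ⟨k, i, ⟨0, S.size_pos k i⟩⟩ •
      (S.colPart e (F * P⁻¹) k).col ⟨i, ⟨0, S.size_pos k i⟩⟩ = 0 := by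
    rw [← hF, h.mulVec_eq_colPart F k hgen]
    ext a
    simp only [mulVec, dotProduct, Fintype.sum_sigma, Finset.sum_apply, Pi.smul_apply, smul_eq_mul]
    refine Finset.sum_congr rfl fun i _ => ?_
    rw [Finset.sum_eq_single (⟨0, S.size_pos k i⟩ : Fin (S.size k i))]
    · rw [mul_comm]; rfl
    · intro j _ hj
      rw [hpos i j fun h0 => hj (Fin.ext h0), mul_zero]
    · simp
  have hzero := Fintype.linearIndependent_iff.1 hlead _ hsum
  refine eq_zero_of_coord_eq_zero (S := S) (e := e) h.1 ?_
  rintro ⟨k', i, j⟩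
  rcases eq_or_ne k' k with rfl | hk
  · by_cases hj : (j : ℕ) = 0
    · have : j = ⟨0, S.size_pos k' i⟩ := Fin.ext hj
      rw [this]
      exact hzero i
    · exact hpos i j hj
  · exact h.coord_eq_zero (fun he => hk (S.eig_injective he)) hgen _

/-- Blocks of size one have no superdiagonal, so the generalized eigenspace is the eigenspace. -/
lemma IsDecomposition.sub_smul_eq_zero_of_mult_le_one (h : S.IsDecomposition e A P) {k : Fin S.m}
    (hk : S.mult k ≤ 1) {w : Fin n → ℂ} (hw : w ∈ Module.End.maxGenEigenspace A.mulVecLin (S.eig k)) :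
    (A.mulVecLin - S.eig k • 1) w = 0 := by
  refine eq_zero_of_coord_eq_zero (S := S) (e := e) h.1 ?_
  rintro ⟨k', i, j⟩
  rw [h.coord_sub_smul]
  rcases eq_or_ne k' k with rfl | hne
  · have : S.size k' i ≤ S.mult k' :=
      Finset.single_le_sum (f := S.size k') (fun _ _ => Nat.zero_le _) (Finset.mem_univ i)
    rw [dif_neg (by omega)]
    simp
  · have h0 := fun j => h.coord_eq_zero (fun he => hne (S.eig_injective he)) hw ⟨i, j⟩
    simp [h0]

/-- If the Hautus-type condition holds and the lead columns of each nonzero `F_k` are linearly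
independent, `F` vanishes on the unobservable subspace. -/
lemma IsDecomposition.mulVec_eq_zero_of_mem_unobservable (h : S.IsDecomposition e A P)
    (hlead : ∀ k, S.colPart e (F * P⁻¹) k ≠ 0 → S.LeadColumnsLI k (S.colPart e (F * P⁻¹) k))
    (hpbh : ∀ (l : ℂ) (w : Fin n → ℂ), A *ᵥ w = l • w → C *ᵥ w = 0 → F *ᵥ w = 0) :
    ∀ w ∈ unobservable C A, F *ᵥ w = 0 := by
  have hpbh' : ∀ (l : ℂ), ∀ w ∈ unobservable C A, (A.mulVecLin - l • 1) w = 0 → F *ᵥ w = 0 :=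
    fun l w hw hl => hpbh l w (by simpa [sub_eq_zero] using hl)
      (FunctObs.mulVec_eq_zero_of_mem_unobservable hw)
  suffices hle : unobservable C A ≤ LinearMap.ker F.mulVecLin from fun w hw => by
    simpa using hle hw
  rw [Submodule.eq_iSup_inf_genEigenspace (f := A.mulVecLin) (p := unobservable C A) ⊤
    (fun w hw => mulVec_mem_unobservable hw) (Module.End.iSup_maxGenEigenspace_eq_top _)]
  refine iSup_le fun μ w hw => ?_
  obtain ⟨hwN, hwG⟩ := hw
  rw [LinearMap.mem_ker, mulVecLin_apply]
  by_cases hμ : ∃ k, S.eig k = μ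
  · obtain ⟨k, rfl⟩ := hμ
    by_cases hFk : S.colPart e (F * P⁻¹) k = 0
    · rw [h.mulVec_eq_colPart F k hwG, hFk, zero_mulVec]
    by_cases hm : 1 < S.mult k
    · have hli := hlead k hFk hm
      obtain ⟨N, hN⟩ := (Module.End.mem_maxGenEigenspace _ _ _).1 hwG
      suffices w = 0 by rw [this, mulVec_zero]
      clear hwG
      -- Induction on the nilpotency exponent: the image of `w` under `A - eig k` is again
      -- unobservable, hence zero, so `w` satisfies the eigenvector equation and `F` kills it.
      induction N generalizing w with
      | zero => simpa using hN
      | succ N ih =>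
        have h0 := ih _ (sub_smul_mem_unobservable (S.eig k) hwN)
          (by rwa [pow_succ, Module.End.mul_apply] at hN)
        exact h.eq_zero_of_eigenvector hli h0 (hpbh' _ w hwN h0)
    · exact hpbh' _ w hwN (h.sub_smul_eq_zero_of_mult_le_one (not_lt.1 hm) hwG)
  · push Not at hμ
    rw [eq_zero_of_coord_eq_zero (S := S) (e := e) h.1 fun j => h.coord_eq_zero (hμ j.1) hwG j.2,
      mulVec_zero]

end JordanShape

/-! ### The rank statements and the equivalences. -/

lemma forall_unobservable_iff_rank_eq {n q r : ℕ} (A : Matrix (Fin n) (Fin n) ℝ)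
    (C : Matrix (Fin q) (Fin n) ℝ) (F : Matrix (Fin r) (Fin n) ℝ) :
    (∀ v ∈ unobservable C A, F *ᵥ v = 0) ↔
      (fromRows (obsMatrix C A) F).rank = (obsMatrix C A).rank := by
  simp only [rank_fromRows_eq_iff, obsMatrix_mulVec_eq_zero_iff_mem]

lemma forall_unobservable_iff_rank_obsMatrix_eq {n q r : ℕ} (A : Matrix (Fin n) (Fin n) ℝ)
    (C : Matrix (Fin q) (Fin n) ℝ) (F : Matrix (Fin r) (Fin n) ℝ) :
    (∀ v ∈ unobservable C A, F *ᵥ v = 0) ↔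
      (fromRows (obsMatrix C A) (obsMatrix F A)).rank = (obsMatrix C A).rank := by
  simp only [rank_fromRows_eq_iff, obsMatrix_mulVec_eq_zero_iff_mem]
  refine ⟨fun h v hv => mem_unobservable.2 fun k => ?_, fun h v hv =>
    mulVec_eq_zero_of_mem_unobservable (h v hv)⟩
  rw [← mulVec_mulVec]
  exact h _ (pow_mulVec_mem_unobservable hv k)

end FunctObs

theorem theorem1 {n p q r : ℕ} (A : Matrix (Fin n) (Fin n) ℝ) (B : Matrix (Fin n) (Fin p) ℝ)
    (C : Matrix (Fin q) (Fin n) ℝ) (F : Matrix (Fin r) (Fin n) ℝ) (t₁ : ℝ) (ht₁ : 0 < t₁) :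
    List.TFAE
      [FunctObs.FunctionallyObservable A B C F t₁,
        (Matrix.fromRows (FunctObs.obsMatrix C A) F).rank = (FunctObs.obsMatrix C A).rank,
        (Matrix.fromRows (FunctObs.obsMatrix C A) (FunctObs.obsMatrix F A)).rank =
          (FunctObs.obsMatrix C A).rank] ∧
    ∀ (S : FunctObs.JordanShape) (e : S.Index ≃ Fin n) (P : Matrix (Fin n) (Fin n) ℂ),
      S.IsDecomposition e (FunctObs.toC A) P →
      (∀ k, S.colPart e (FunctObs.toC F * P⁻¹) k ≠ 0 →
        S.LeadColumnsLI k (S.colPart e (FunctObs.toC F * P⁻¹) k)) →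
      List.TFAE
        [FunctObs.FunctionallyObservable A B C F t₁,
          (Matrix.fromRows (FunctObs.obsMatrix C A) F).rank = (FunctObs.obsMatrix C A).rank,
          (Matrix.fromRows (FunctObs.obsMatrix C A) (FunctObs.obsMatrix F A)).rank =
            (FunctObs.obsMatrix C A).rank,
          FunctObs.GeneralizedPBH A C F] := by
  have h12 := (FunctObs.functionallyObservable_iff (A := A) (C := C) (F := F) B ht₁).trans
    (FunctObs.forall_unobservable_iff_rank_eq A C F)
  have h23 := (FunctObs.forall_unobservable_iff_rank_eq A C F).symm.trans
    (FunctObs.forall_unobservable_iff_rank_obsMatrix_eq A C F)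
  refine ⟨?_, fun S e P hS hlead => ?_⟩
  · tfae_have 1 ↔ 2 := h12
    tfae_have 2 ↔ 3 := h23
    tfae_finish
  · tfae_have 1 ↔ 2 := h12
    tfae_have 2 ↔ 3 := h23
    tfae_have 2 ↔ 4 := by
      rw [← FunctObs.forall_unobservable_iff_rank_eq, ← FunctObs.forall_unobservable_toC_iff,
        FunctObs.generalizedPBH_iff]
      exact ⟨fun h l w hA hC => h w (FunctObs.mem_unobservable_of_eigenvector hA hC),
        hS.mulVec_eq_zero_of_mem_unobservable hlead⟩
    tfae_finish
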